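/- **Setting.** An algebra is $\mathbb A=(A,\mathcal O)$ with $\mathcal O=(f_j)_{j\in J}$ a possibly infinite indexed family of finitary operations on the set $A$. Let $\mathcal U$ be an ultrafilter on a set $I$ and, for a set $X$, let ${}^*X=X^I/\mathcal U$, with $x\in X$ identified with the class ${}^*x$ of the constant family. A subset of ${}^*X$ is *internal* if it has the form $\{[a_i] : \{i : a_i\in S_i\}\in\mathcal U\}$ for some family $(S_i)_{i\in I}$ of subsets of $X$. Let $V(A)=\bigcup_n V_n$ be the superstructure over $A$ (the elements of $A$ being urelements): $V_0=A$, $V_{n+1}=V_n\cup\mathcal P(V_n)$. Assume that the ultrapower is a (saturated) enlargement of $V(A)$, that is, that it satisfies the *concurrency principle for internal relations*: for all sets $X,Y\in V(A)$ and every internal relation $r\subseteq {}^*(X\times Y)={}^*X\times{}^*Y$, if for each finite $C\subseteq X$ there is $b\in{}^*Y$ with ${}^*x\mathrel r b$ for all $x\in C$, then there is $b\in{}^*Y$ with ${}^*x\mathrel r b$ for all $x\in X$. The algebra ${}^*\mathbb A=({}^*A,{}^*\mathcal O)$ has as operations all internal operations $[f_{j_i}]$, for $[j_i]\in{}^*J$;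 the arity of such an operation is the hypernatural number $[\operatorname{arity} f_{j_i}]$, and it is applied to internal tuples of that length. A subalgebra of ${}^*\mathbb A$ is a subset of ${}^*A$ that contains the value of every operation in ${}^*\mathcal O$ at every internal tuple all of whose entries lie in the subset. The *standard reduct* of a subalgebra $\mathbb S$ of ${}^*\mathbb A$ is $\mathbb S|_{\mathcal O}=(S;({}^*f|_S)_{f\in\mathcal O})$, and $\mathbb A$ is a *subreduct* of $\mathbb S$ if it is a subalgebra of $\mathbb S|_{\mathcal O}$. The *extension monad* of $\mathbb A$ is $$\hat{\mathbb A}=\bigcap\{\mathbb B\le{}^*\mathbb A : \mathbb B\text{ is internal and }\mathbb A\text{ is a subreduct of }\mathbb B\}.$$ The algebra $\mathbb A$ is *locally finite* if every finitely generated subalgebra of $\mathbb A$ is finite. **Theorem.** Under these assumptions, $\mathbb A$ is locally finite if and only if $\hat{\mathbb A}|_{\mathcal O}=\mathbb A$. -/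

import Mathlib

universe u v w x

namespace ExtMonad

open FirstOrder FirstOrder.Language Filter

/-! ### The superstructure and its ultrapowers -/

/-- The finite levels of the superstructure over a set `U` of urelements:
`V₀ = U` and `Vₙ₊₁ = Vₙ ∪ 𝒫(Vₙ)`, the union being tagged. A set belonging to the superstructure
is a subset of one of these levels. -/
def Level (U : Type u) : ℕ → Type u
  | 0 => U
  | n + 1 => Level U n ⊕ Set (Level U n)

section Star

variable {I : Type x} (𝒰 : Ultrafilter I)

/-- The ultrapower `*X = X ^ I / 𝒰`. -/
abbrev Star (X : Type*) : Type _ := (𝒰 : Filter I).Product (fun _ => X)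

/-- The class `[a]` of a family `a` in the ultrapower. -/
def toStar {X : Type*} (a : I → X) : Star 𝒰 X := Quotient.mk _ a

/-- The `*`-transform of an element: the class of the constant family. -/
def star {X : Type*} (a : X) : Star 𝒰 X := toStar 𝒰 (fun _ => a)

/-- Membership modulo `𝒰`: `[a] ∈ [S]` if and only if `{i | a i ∈ S i} ∈ 𝒰`. -/
def starMem {X : Type*} (a : Star 𝒰 X) (S : Star 𝒰 (Set X)) : Prop :=
  ∃ (a' : I → X) (S' : I → Set X), toStar 𝒰 a' = a ∧ toStar 𝒰 S' = S ∧ ∀ᶠ i in 𝒰, a' i ∈ S' i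

/-- A set of elements of `*X` is internal if it is (the set of members of) an element
of `*𝒫(X)`. -/
def IsInternal {X : Type*} (B : Set (Star 𝒰 X)) : Prop :=
  ∃ S : Star 𝒰 (Set X), B = {a | starMem 𝒰 a S}

/-- The pair, as an element of `*(X × Y)`, of an element of `*X` and an element of `*Y`. -/
def starPair {X Y : Type*} (a : Star 𝒰 X) (b : Star 𝒰 Y) : Star 𝒰 (X × Y) :=
  Quotient.map₂ (fun a b i => (a i, b i))
    (fun _ _ ha _ _ hb => by
      filter_upwards [ha, hb] with i h₁ h₂
      simp [h₁, h₂]) a b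

/-- The concurrency principle for an internal relation `r ∈ *𝒫(X × Y)`: if for
every finite set `C` of standard elements of `*X` there is an `r`-bound `b ∈ *Y`, then there is
a single `b ∈ *Y` that is an `r`-bound of all standard elements of `*X`. -/
def ConcurrencyPrinciple (X Y : Type*) : Prop :=
  ∀ r : Star 𝒰 (Set (X × Y)),
    (∀ C : Finset X, ∃ b : Star 𝒰 Y, ∀ a ∈ C, starMem 𝒰 (starPair 𝒰 (star 𝒰 a) b) r) →
      ∃ b : Star 𝒰 Y, ∀ a : X, starMem 𝒰 (starPair 𝒰 (star 𝒰 a) b) r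

/-- The ultrapower by `𝒰` is a saturated enlargement of the superstructure over `U`:
the concurrency principle holds for all internal relations between sets `X` and `Y` of that
superstructure. -/
def IsSaturatedEnlargement (U : Type u) : Prop :=
  ∀ (m n : ℕ) (X : Set (Level U m)) (Y : Set (Level U n)), ConcurrencyPrinciple 𝒰 X Y

end Star

/-! ### Algebras -/

/-- An algebra is locally finite if all its finitely generated subalgebras are finite. -/
def LocallyFinite (L : FirstOrder.Language.{v, w}) (A : Type u) [L.Structure A] : Prop :=
  ∀ S : L.Substructure A, S.FG → Finite S

/-- The operation symbols of all arities. -/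
abbrev Op (L : FirstOrder.Language.{v, w}) : Type v := Σ n : ℕ, L.Functions n

/-- The finite tuples of elements of `A`. -/
abbrev Tuple (A : Type u) : Type u := Σ n : ℕ, (Fin n → A)

/-- `y` is an entry of the tuple `t`. -/
def IsEntry {A : Type u} (y : A) (t : Tuple A) : Prop := ∃ k, t.2 k = y

/-- `t` is a tuple whose length is the arity of `o`, and `y = o(t)`. -/
def IsValue {L : FirstOrder.Language.{v, w}} {A : Type u} [L.Structure A]
    (o : Op L) (t : Tuple A) (y : A) : Prop :=
  ∃ a : Fin o.1 → A, t = ⟨o.1, a⟩ ∧ y = Structure.funMap o.2 a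

section Internal

variable {I : Type x} (𝒰 : Ultrafilter I)

/-- The `*`-transform of `IsEntry`: `y ∈ *A` is one of the entries of the internal tuple `t` (whose
length is a hypernatural number). -/
def StarIsEntry {A : Type u} (y : Star 𝒰 A) (t : Star 𝒰 (Tuple A)) : Prop :=
  ∃ (y' : I → A) (t' : I → Tuple A), toStar 𝒰 y' = y ∧ toStar 𝒰 t' = t ∧ ∀ᶠ i in 𝒰, IsEntry (y' i) (t' i)

/-- The `*`-transform of `IsValue`: `t` is an internal tuple of elements of `*A`, its length is the
(hyperfinite) arity of the internal operation `o ∈ *𝒪`, and `y` is the value of `o` at `t`. -/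
def StarIsValue {L : FirstOrder.Language.{v, w}} {A : Type u} [L.Structure A]
    (o : Star 𝒰 (Op L)) (t : Star 𝒰 (Tuple A)) (y : Star 𝒰 A) : Prop :=
  ∃ (o' : I → Op L) (t' : I → Tuple A) (y' : I → A), toStar 𝒰 o' = o ∧ toStar 𝒰 t' = t ∧ toStar 𝒰 y' = y ∧
    ∀ᶠ i in 𝒰, IsValue (o' i) (t' i) (y' i)

variable (L : FirstOrder.Language.{v, w}) (A : Type u) [L.Structure A]

/-- The subalgebras of `*𝔸 = (*A, *𝒪)`, internal or not: the sets of elements of `*A` that are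
closed under all operations in `*𝒪`. -/
structure StarSubalgebra where
  /-- the underlying set -/
  carrier : Set (Star 𝒰 A)
  closed : ∀ (o : Star 𝒰 (Op L)) (t : Star 𝒰 (Tuple A)) (y : Star 𝒰 A),
    StarIsValue 𝒰 o t y → (∀ z, StarIsEntry 𝒰 z t → z ∈ carrier) → y ∈ carrier

variable {L A}

theorem funMap_toStar {n : ℕ} (f : L.Functions n) (a : Fin n → I → A) :
    Structure.funMap f (fun k => toStar 𝒰 (a k)) =
      toStar 𝒰 (fun i => Structure.funMap f (fun k => a k i)) :=
  Ultraproduct.funMap_cast (M := fun _ : I => A) (u := 𝒰) f a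

variable {𝒰}

/-- The standard reduct `S|_𝒪 = (S; {*f | f ∈ 𝒪})` of a subalgebra `S` of `*𝔸`, as a subalgebra of
the reduct `(*A; {*f | f ∈ 𝒪})` of `*𝔸`, which is the ultrapower of `𝔸` as an `L`-structure. -/
def StarSubalgebra.reduct (S : StarSubalgebra 𝒰 L A) : L.Substructure (Star 𝒰 A) where
  carrier := S.carrier
  fun_mem {n} f a ha := by
    choose a' ha' using fun k => Quotient.exists_rep (a k)
    have hfun : a = fun k => toStar 𝒰 (a' k) := funext fun k => (ha' k).symm
    refine S.closed (star 𝒰 ⟨n, f⟩) (toStar 𝒰 fun i => ⟨n, fun k => a' k i⟩) _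
      ⟨fun _ => ⟨n, f⟩, fun i => ⟨n, fun k => a' k i⟩,
        fun i => Structure.funMap f (fun k => a' k i), rfl, rfl, ?_, ?_⟩ ?_
    · rw [hfun, funMap_toStar]
    · exact Eventually.of_forall fun i => ⟨_, rfl, rfl⟩
    · rintro z ⟨z', t', rfl, ht, hz⟩
      have hz' : ∀ᶠ i in (𝒰 : Filter I), ∃ k : Fin n, a' k i = z' i := by
        filter_upwards [hz, Quotient.exact ht] with i h₁ h₂
        rw [h₂] at h₁
        exact h₁
      obtain ⟨k, hk⟩ := Ultrafilter.eventually_exists_iff.1 hz'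
      have : toStar 𝒰 z' = a k := by
        rw [hfun]
        exact Quotient.sound (hk.mono fun i h => h.symm)
      rw [this]
      exact ha k

variable (𝒰 L A)

/-- The `*`-embedding of `𝔸` into the reduct `(*A; {*f | f ∈ 𝒪})` of `*𝔸`, for an
algebra `𝔸` (that is, a structure for a language without relation symbols). -/
def starHom [L.IsAlgebraic] : A →[L] Star 𝒰 A where
  toFun := star 𝒰
  map_fun' f a := (funMap_toStar 𝒰 f (fun k _ => a k)).symm
  map_rel' r := isEmptyElim r

/-- The copy of `𝔸` inside `*𝔸`, with which `𝔸` is identified. -/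
def standardCopy [L.IsAlgebraic] : L.Substructure (Star 𝒰 A) := (starHom 𝒰 L A).range

/-- The extension monad of `𝔸`: the intersection of all internal subalgebras of `*𝔸` of
which `𝔸` is a subreduct (that is, a subalgebra of the standard reduct). -/
def extensionMonad [L.IsAlgebraic] : StarSubalgebra 𝒰 L A where
  carrier := {y | ∀ B : StarSubalgebra 𝒰 L A,
    IsInternal 𝒰 B.carrier → standardCopy 𝒰 L A ≤ B.reduct → y ∈ B.carrier}
  closed o t y h ht B hB hA := B.closed o t y h fun z hz => ht z hz B hB hA

end Internal

end ExtMonad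

/-!
The internal subalgebras of `*𝔸` are exactly the classes `[Sᵢ]` of families of subalgebras of `𝔸`
(`ExtMonad.exists_carrier_eq_internalSubalgebra`): this is the transfer principle for closure under
the operations, and it makes both implications instances of concurrency.

If `𝔸` is locally finite and `y ∈ *A` is not standard, consider the internal relation
`a ∈ S ∧ y ∉ S` between `A` and the set of subalgebras of `𝔸`. A finite `C ⊆ A` generates a finite
subalgebra `S`, so `*S` has only standard elements and omits `y`. By concurrency there is an
internal subalgebra of `*𝔸` that contains all of `A` and omits `y`; hence `y` is not in the
extension monad.

Conversely, let `S` be the subalgebra generated by a finite set `C ⊆ A`. An internal subalgebra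
`[Bᵢ]` containing `C` satisfies `C ⊆ Bᵢ`, and so `S ⊆ Bᵢ`, for almost all `i`. Hence `*S` lies in
the extension monad (`ExtMonad.mem_extensionMonad_of_eventually_mem`). If `S` were infinite,
concurrency for the relation `≠` on `S` would give a nonstandard element of `*S`.
-/

namespace ExtMonad

open FirstOrder FirstOrder.Language Filter

/-! ### Ultrapowers and concurrency -/

section Star

variable {I : Type*} {𝒰 : Ultrafilter I}

theorem toStar_eq_toStar_iff {X : Type*} {a b : I → X} :
    toStar 𝒰 a = toStar 𝒰 b ↔ ∀ᶠ i in 𝒰, a i = b i :=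
  ⟨fun h => Quotient.exact h, fun h => Quotient.sound h⟩

theorem exists_toStar_eq {X : Type*} (a : Star 𝒰 X) : ∃ a' : I → X, toStar 𝒰 a' = a :=
  Quotient.exists_rep a

theorem starMem_toStar_iff {X : Type*} {a : I → X} {S : I → Set X} :
    starMem 𝒰 (toStar 𝒰 a) (toStar 𝒰 S) ↔ ∀ᶠ i in 𝒰, a i ∈ S i := by
  refine ⟨?_, fun h => ⟨a, S, rfl, rfl, h⟩⟩
  rintro ⟨a', S', ha, hS, h⟩
  filter_upwards [toStar_eq_toStar_iff.1 ha, toStar_eq_toStar_iff.1 hS, h] with i h₁ h₂ h₃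
  rwa [← h₁, ← h₂]

theorem starPair_toStar {X Y : Type*} (a : I → X) (b : I → Y) :
    starPair 𝒰 (toStar 𝒰 a) (toStar 𝒰 b) = toStar 𝒰 fun i => (a i, b i) :=
  rfl

/-- A finite set acquires no new elements in the ultrapower. -/
theorem exists_star_eq_of_eventually_mem {X : Type*} {s : Set X} (hs : s.Finite) {a : I → X}
    (ha : ∀ᶠ i in 𝒰, a i ∈ s) : ∃ c ∈ s, star 𝒰 c = toStar 𝒰 a := by
  obtain ⟨c, hc, h⟩ := (Ultrafilter.eventually_exists_mem_iff (P := fun c i => c = a i) hs).1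
    (ha.mono fun i hi => ⟨a i, hi, rfl⟩)
  exact ⟨c, hc, toStar_eq_toStar_iff.2 h⟩

/-- The concurrency principle in terms of families representing the internal relation and the
bounds. -/
theorem ConcurrencyPrinciple.exists_forall_eventually {X Y : Type*}
    (h : ConcurrencyPrinciple 𝒰 X Y) (r : I → X → Y → Prop)
    (hr : ∀ C : Finset X, ∃ b : I → Y, ∀ a ∈ C, ∀ᶠ i in 𝒰, r i a (b i)) :
    ∃ b : I → Y, ∀ a, ∀ᶠ i in 𝒰, r i a (b i) := by
  have key (a : X) (b : I → Y) :
      starMem 𝒰 (starPair 𝒰 (star 𝒰 a) (toStar 𝒰 b)) (toStar 𝒰 fun i => {p | r i p.1 p.2}) ↔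
        ∀ᶠ i in 𝒰, r i a (b i) := by
    rw [star, starPair_toStar, starMem_toStar_iff]
    rfl
  obtain ⟨b, hb⟩ := h (toStar 𝒰 fun i => {p | r i p.1 p.2}) fun C => by
    obtain ⟨b, hb⟩ := hr C
    exact ⟨toStar 𝒰 b, fun a ha => (key a b).2 (hb a ha)⟩
  obtain ⟨b, rfl⟩ := exists_toStar_eq b
  exact ⟨b, fun a => (key a b).1 (hb a)⟩

theorem ConcurrencyPrinciple.congr {X Y X' Y' : Type*} (h : ConcurrencyPrinciple 𝒰 X Y)
    (e : X ≃ X') (f : Y ≃ Y') : ConcurrencyPrinciple 𝒰 X' Y' := by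
  intro r hr
  obtain ⟨r, rfl⟩ := exists_toStar_eq r
  obtain ⟨b, hb⟩ := h.exists_forall_eventually (fun i x y => (e x, f y) ∈ r i) fun C => by
    obtain ⟨b, hb⟩ := hr (C.map e.toEmbedding)
    obtain ⟨b, rfl⟩ := exists_toStar_eq b
    refine ⟨fun i => f.symm (b i), fun a ha => ?_⟩
    simpa [star, starPair_toStar, starMem_toStar_iff] using hb (e a) (by simpa using ha)
  refine ⟨toStar 𝒰 fun i => f (b i), fun a => ?_⟩
  simpa [star, starPair_toStar, starMem_toStar_iff] using hb (e.symm a)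

end Star

/-! ### Internal subalgebras -/

section Internal

variable {I : Type*} {𝒰 : Ultrafilter I} {L : FirstOrder.Language} {A : Type*} [L.Structure A]

theorem IsValue.mem {o : Op L} {t : Tuple A} {y : A} (h : IsValue o t y) (S : L.Substructure A)
    (ht : ∀ z, IsEntry z t → z ∈ S) : y ∈ S := by
  obtain ⟨a, rfl, rfl⟩ := h
  exact S.fun_mem o.2 a fun k => ht _ ⟨k, rfl⟩

theorem starIsEntry_toStar_iff {y : I → A} {t : I → Tuple A} :
    StarIsEntry 𝒰 (toStar 𝒰 y) (toStar 𝒰 t) ↔ ∀ᶠ i in 𝒰, IsEntry (y i) (t i) := by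
  refine ⟨?_, fun h => ⟨y, t, rfl, rfl, h⟩⟩
  rintro ⟨y', t', hy, ht, h⟩
  filter_upwards [toStar_eq_toStar_iff.1 hy, toStar_eq_toStar_iff.1 ht, h] with i h₁ h₂ h₃
  rwa [← h₁, ← h₂]

/-- If all entries of an internal tuple `[tᵢ]` lie in `[Sᵢ]`, then almost all of the `tᵢ` have all
their entries in `Sᵢ`. -/
theorem eventually_entries_mem {t : I → Tuple A} {S : I → Set A}
    (h : ∀ z, StarIsEntry 𝒰 z (toStar 𝒰 t) → starMem 𝒰 z (toStar 𝒰 S)) :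
    ∀ᶠ i in 𝒰, ∀ z, IsEntry z (t i) → z ∈ S i := by
  by_contra hn
  rw [← Ultrafilter.eventually_not] at hn
  push Not at hn
  obtain ⟨z, hz⟩ := hn.choice
  obtain ⟨i, h₁, h₂⟩ := ((starMem_toStar_iff.1
    (h _ (starIsEntry_toStar_iff.2 (hz.mono fun _ h => h.1)))).and hz).exists
  exact h₂.2 h₁

variable (𝒰) in
/-- The internal subalgebra `[Sᵢ]` of `*𝔸` given by a family of subalgebras of `𝔸`. -/
def internalSubalgebra (S : I → L.Substructure A) : StarSubalgebra 𝒰 L A where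
  carrier := {a | starMem 𝒰 a (toStar 𝒰 fun i => (S i : Set A))}
  closed := by
    rintro _ _ _ ⟨o, t, y, rfl, rfl, rfl, h⟩ ht
    refine starMem_toStar_iff.2 ?_
    filter_upwards [h, eventually_entries_mem ht] with i h₁ h₂
    exact h₁.mem (S i) h₂

theorem toStar_mem_internalSubalgebra {S : I → L.Substructure A} {a : I → A} :
    toStar 𝒰 a ∈ (internalSubalgebra 𝒰 S).carrier ↔ ∀ᶠ i in 𝒰, a i ∈ S i :=
  starMem_toStar_iff

theorem isInternal_internalSubalgebra (S : I → L.Substructure A) :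
    IsInternal 𝒰 (internalSubalgebra 𝒰 S).carrier :=
  ⟨_, rfl⟩

/-- Transfer for closure under the operations: if `[Sᵢ]` is closed under all internal operations,
then almost all of the `Sᵢ` are subalgebras of `𝔸`. -/
theorem eventually_exists_substructure {S : I → Set A} {B : StarSubalgebra 𝒰 L A}
    (hB : B.carrier = {a | starMem 𝒰 a (toStar 𝒰 S)}) :
    ∀ᶠ i in 𝒰, ∃ T : L.Substructure A, (T : Set A) = S i := by
  by_contra hn
  rw [← Ultrafilter.eventually_not] at hn
  have hbad : ∀ᶠ i in 𝒰, ∃ p : Op L × Tuple A × A,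
      IsValue p.1 p.2.1 p.2.2 ∧ (∀ z, IsEntry z p.2.1 → z ∈ S i) ∧ p.2.2 ∉ S i := by
    filter_upwards [hn] with i hi
    by_contra hc
    push Not at hc
    refine hi ⟨⟨S i, fun {n} f a ha => ?_⟩, rfl⟩
    refine hc (⟨n, f⟩, ⟨n, a⟩, Structure.funMap f a) ⟨a, rfl, rfl⟩ ?_
    rintro _ ⟨k, rfl⟩
    exact ha k
  obtain ⟨p, hp⟩ := hbad.choice
  have hmem : toStar 𝒰 (fun i => (p i).2.2) ∈ B.carrier := by
    refine B.closed (toStar 𝒰 fun i => (p i).1) (toStar 𝒰 fun i => (p i).2.1) _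
      ⟨_, _, _, rfl, rfl, rfl, hp.mono fun _ h => h.1⟩ fun z hz => ?_
    obtain ⟨z, rfl⟩ := exists_toStar_eq z
    rw [hB]
    refine starMem_toStar_iff.2 ?_
    filter_upwards [hp, starIsEntry_toStar_iff.1 hz] with i h₁ h₂
    exact h₁.2.1 _ h₂
  rw [hB] at hmem
  obtain ⟨i, h₁, h₂⟩ := ((starMem_toStar_iff.1 hmem).and hp).exists
  exact h₂.2.2 h₁

theorem exists_carrier_eq_internalSubalgebra {B : StarSubalgebra 𝒰 L A}
    (hB : IsInternal 𝒰 B.carrier) :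
    ∃ S : I → L.Substructure A, B.carrier = (internalSubalgebra 𝒰 S).carrier := by
  obtain ⟨S, hS⟩ := hB
  obtain ⟨S, rfl⟩ := exists_toStar_eq S
  obtain ⟨T, hT⟩ := (eventually_exists_substructure hS).choice
  refine ⟨T, ?_⟩
  rw [hS, ← toStar_eq_toStar_iff.2 hT]
  rfl

/-- Concurrency with `A` on the left and the subalgebras of `𝔸`, which belong to the
superstructure as subsets of its lowest level, on the right. -/
theorem IsSaturatedEnlargement.concurrencyPrinciple_substructure
    (h : IsSaturatedEnlargement 𝒰 A) : ConcurrencyPrinciple 𝒰 A (L.Substructure A) :=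
  (h 0 1 Set.univ (Set.range fun S : L.Substructure A => Sum.inr (S : Set A))).congr
    (Equiv.Set.univ A)
    (Equiv.ofInjective _ (Sum.inr_injective.comp SetLike.coe_injective)).symm

end Internal

/-! ### The extension monad -/

section ExtensionMonad

variable {I : Type*} {𝒰 : Ultrafilter I} {L : FirstOrder.Language} [L.IsAlgebraic] {A : Type*}
  [L.Structure A]

theorem standardCopy_le_reduct_iff {B : StarSubalgebra 𝒰 L A} :
    standardCopy 𝒰 L A ≤ B.reduct ↔ ∀ a : A, star 𝒰 a ∈ B.carrier := by
  refine ⟨fun h a => h ⟨a, rfl⟩, ?_⟩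
  rintro h _ ⟨a, rfl⟩
  exact h a

theorem standardCopy_le_reduct_extensionMonad :
    standardCopy 𝒰 L A ≤ (extensionMonad 𝒰 L A).reduct :=
  fun _ hx _ _ hA => hA hx

/-- The `*`-transform of a finitely generated subalgebra lies in the extension monad. -/
theorem mem_extensionMonad_of_eventually_mem {S : L.Substructure A} (hS : S.FG) {a : I → A}
    (ha : ∀ᶠ i in 𝒰, a i ∈ S) : toStar 𝒰 a ∈ (extensionMonad 𝒰 L A).carrier := by
  intro B hB hA
  obtain ⟨T, hT⟩ := exists_carrier_eq_internalSubalgebra hB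
  obtain ⟨C, rfl⟩ := hS
  have hC : ∀ᶠ i in 𝒰, ∀ c ∈ C, c ∈ T i := by
    refine (eventually_all_finset C).2 fun c _ => ?_
    have hc := standardCopy_le_reduct_iff.1 hA c
    rw [hT] at hc
    exact toStar_mem_internalSubalgebra.1 hc
  rw [hT, toStar_mem_internalSubalgebra]
  filter_upwards [ha, hC] with i h₁ h₂
  exact Substructure.closure_le.2 h₂ h₁

theorem reduct_extensionMonad_le_of_locallyFinite (h𝒰 : IsSaturatedEnlargement 𝒰 A)
    (h : LocallyFinite L A) : (extensionMonad 𝒰 L A).reduct ≤ standardCopy 𝒰 L A := by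
  intro y hy
  by_contra hn
  obtain ⟨y, rfl⟩ := exists_toStar_eq y
  obtain ⟨S, hS⟩ := h𝒰.concurrencyPrinciple_substructure.exists_forall_eventually
    (fun i a (S : L.Substructure A) => a ∈ S ∧ y i ∉ S) fun C => by
      refine ⟨fun _ => Substructure.closure L (C : Set A), fun a ha => ?_⟩
      have hfin : (Substructure.closure L (C : Set A) : Set A).Finite := h _ ⟨C, rfl⟩
      refine (Eventually.of_forall fun _ => Substructure.subset_closure ha).and ?_
      refine Ultrafilter.eventually_not.2 fun hy => hn ?_
      obtain ⟨c, -, hc⟩ := exists_star_eq_of_eventually_mem hfin hy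
      exact ⟨c, hc⟩
  have hyS := hy (internalSubalgebra 𝒰 S) (isInternal_internalSubalgebra S)
    (standardCopy_le_reduct_iff.2 fun a =>
      toStar_mem_internalSubalgebra.2 ((hS a).mono fun _ h => h.1))
  obtain ⟨i, -⟩ := (toStar_mem_internalSubalgebra.1 hyS).exists
  -- The relation gives `y ∉ [Sᵢ]` at any standard element; a value of `y` supplies one.
  obtain ⟨j, h₁, h₂⟩ := ((toStar_mem_internalSubalgebra.1 hyS).and (hS (y i))).exists
  exact h₂.2 h₁

theorem locallyFinite_of_reduct_extensionMonad_le (h𝒰 : IsSaturatedEnlargement 𝒰 A)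
    (h : (extensionMonad 𝒰 L A).reduct ≤ standardCopy 𝒰 L A) : LocallyFinite L A := by
  intro S hS
  by_contra hfin
  rw [not_finite_iff_infinite] at hfin
  have hconc : ConcurrencyPrinciple 𝒰 S S := h𝒰 0 0 (S : Set A) (S : Set A)
  obtain ⟨b, hb⟩ := hconc.exists_forall_eventually (fun _ x y => x ≠ y) fun C => by
    obtain ⟨b, hb⟩ := Infinite.exists_notMem_finset C
    exact ⟨fun _ => b, fun a ha => Eventually.of_forall fun _ => ne_of_mem_of_not_mem ha hb⟩
  obtain ⟨c, hc⟩ := h (mem_extensionMonad_of_eventually_mem hS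
    (Eventually.of_forall fun i => (b i).2) : toStar 𝒰 (fun i => (b i : A)) ∈ _)
  have hcb : ∀ᶠ i in 𝒰, c = b i := toStar_eq_toStar_iff.1 hc
  obtain ⟨i, hi⟩ := hcb.exists
  -- A standard element of `*S` belongs to `S`, so that the choice of `b` applies to it.
  have hcS : c ∈ S := hi ▸ (b i).2
  obtain ⟨j, h₁, h₂⟩ := (hcb.and (hb ⟨c, hcS⟩)).exists
  exact h₂ (Subtype.ext h₁)

end ExtensionMonad

end ExtMonad

theorem mainTheorem4 {L : FirstOrder.Language.{v, w}} [L.IsAlgebraic]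
    {A : Type u} [L.Structure A] {I : Type x} (𝒰 : Ultrafilter I)
    (h𝒰 : ExtMonad.IsSaturatedEnlargement 𝒰 A) :
    ExtMonad.LocallyFinite L A ↔
      (ExtMonad.extensionMonad 𝒰 L A).reduct = ExtMonad.standardCopy 𝒰 L A :=
  ⟨fun h => le_antisymm (ExtMonad.reduct_extensionMonad_le_of_locallyFinite h𝒰 h)
      ExtMonad.standardCopy_le_reduct_extensionMonad,
    fun h => ExtMonad.locallyFinite_of_reduct_extensionMonad_le h𝒰 h.le⟩
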